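/- Let $m\ge 1$ and let $A_1,\dots,A_m$ and $Z_1,\dots,Z_m$ be complex $n\times n$ matrices such that every $A_i$ is normal and every $Z_i$ is expansive, that is, $Z_i^*Z_i\ge I$. Let $f$ be a non-negative concave function on $[0,\infty)$ which is e-convex, that is, $t\mapsto f(e^t)$ is convex on $(-\infty,\infty)$. Then, for every symmetric norm $\|\cdot\|$ on the $n\times n$ complex matrices (a norm with $\|UAV\|=\|A\|$ for all $A$ and all unitary $U,V$), $$\left\| f\left(\left|\sum_{i=1}^m Z_i^*A_iZ_i\right|\right)\right\|\le\left\|\sum_{i=1}^m Z_i^*f(|A_i|)Z_i\right\|,$$ where $|X|=(X^*X)^{1/2}$ and $f$ of a positive semi-definite matrix is defined by the functional calculus. -/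

import Mathlib

open scoped Matrix MatrixOrder ComplexOrder

/-- `Z` is expansive: `Z* Z` dominates the identity in the Loewner order. -/
def IsExpansive {n : ℕ} (Z : Matrix (Fin n) (Fin n) ℂ) : Prop :=
  (Zᴴ * Z - 1).PosSemidef

/-- A symmetric (unitarily invariant) norm on the complex `n × n` matrices: a norm `N` with
`N (U A V) = N A` for all matrices `A` and all unitary matrices `U`, `V`.
(`Seminorm` carries the triangle inequality and absolute homogeneity over `ℂ`.) -/
structure IsSymmetricNorm {n : ℕ} (N : Seminorm ℂ (Matrix (Fin n) (Fin n) ℂ)) : Prop where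
  eq_zero_of_apply_eq_zero : ∀ A : Matrix (Fin n) (Fin n) ℂ, N A = 0 → A = 0
  unitary_invariant : ∀ A U V : Matrix (Fin n) (Fin n) ℂ,
    U ∈ Matrix.unitaryGroup (Fin n) ℂ → V ∈ Matrix.unitaryGroup (Fin n) ℂ →
      N (U * A * V) = N A

/-- A function on `[0, ∞)` is e-convex if `t ↦ f (exp t)` is convex on `(-∞, ∞)`. -/
def IsEConvex (f : ℝ → ℝ) : Prop :=
  ConvexOn ℝ Set.univ (fun t : ℝ => f (Real.exp t))

/-! Write T = Σ Zᵢ*AᵢZᵢ and S = Σ Zᵢ*|Aᵢ|Zᵢ, with σ the decreasing singular values of T and s the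
decreasing eigenvalues of S. The proof inserts f(s) between the two sides.

Normality makes the block matrix [[S, T*], [T, S]] positive semidefinite, which gives ∏ σⱼ ≤ ∏ sⱼ
over every initial segment (`Matrix.prod_singularValues_le`). As f is increasing and e-convex, the
initial sums of f(σⱼ) are then bounded by those of f(sⱼ) (`sum_le_sum_of_prod_le_prod`).

In an eigenbasis E of S, each sⱼ is Σᵣ αᵣwᵣⱼ, where the αᵣ are the eigenvalues of all the |Aᵢ| and
the weights wᵣⱼ are squared moduli of matrix entries. Expansiveness bounds the row and column sums
of w below by 1, and positivity gives Σⱼ αᵣwᵣⱼ/sⱼ ≤ 1. Concavity then bounds the initial sums of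
f(sⱼ) by those of dⱼ = Σᵣ f(αᵣ)wᵣⱼ (`sum_le_sum_sum_weight`).

The dⱼ are the diagonal entries of the right-hand matrix in the basis E. A symmetric norm respects
weak majorization of diagonals (`IsSymmetricNorm.diagonal_le`) and does not increase under pinching
(`IsSymmetricNorm.diagonal_diag_le`). -/

/-! ### Scalar inequalities: majorization from e-convexity and from concavity -/

/-- Abel summation: an antitone nonnegative weight paired with a sequence whose partial sums are
nonnegative (where the weight is positive) gives a nonnegative sum. -/
theorem sum_mul_nonneg_of_antitone {n : ℕ} (c a : Fin n → ℝ) (hc : Antitone c)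
    (hc0 : ∀ j, 0 ≤ c j) (ha : ∀ k, 0 < c k → 0 ≤ ∑ j ∈ Finset.Iic k, a j) :
    0 ≤ ∑ j, c j * a j := by
  induction n with
  | zero => simp
  | succ n ih =>
    have hIic : ∀ k : Fin n, ∑ j ∈ Finset.Iic k.castSucc, a j
        = ∑ j ∈ Finset.Iic k, a j.castSucc := by
      intro k
      have h1 : ∀ (m : ℕ) (k : Fin m), Finset.Iic k = Finset.univ.filter (· ≤ k) := by
        intro m k; ext; simp
      rw [h1, h1, Finset.sum_filter, Finset.sum_filter, Fin.sum_univ_castSucc]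
      simp only [Fin.castSucc_le_castSucc_iff]
      rw [if_neg (not_le.mpr (Fin.castSucc_lt_last k)), add_zero]
    have h := ih (fun j => c j.castSucc - c (Fin.last n)) (fun j => a j.castSucc)
      (fun i j hij => by
        have := hc (Fin.castSucc_le_castSucc_iff.mpr hij); simp only; linarith)
      (fun j => sub_nonneg.mpr (hc (Fin.le_last _)))
      (fun k hk => by
        rw [← hIic]; exact ha _ (by have := hc0 (Fin.last n); linarith))
    have hl : 0 ≤ c (Fin.last n) * ∑ j, a j := by
      rcases (hc0 (Fin.last n)).eq_or_lt with h0 | h0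
      · simp [← h0]
      · have := ha _ h0
        rw [show Finset.Iic (Fin.last n) = Finset.univ by ext; simp [Fin.le_last]] at this
        positivity
    rw [Fin.sum_univ_castSucc] at hl ⊢
    simp only [sub_mul, Finset.sum_sub_distrib, ← Finset.mul_sum] at h
    linarith [mul_add (c (Fin.last n)) (∑ j : Fin n, a j.castSucc) (a (Fin.last n))]

theorem ConcaveOn.monotoneOn_Ici_of_nonneg {f : ℝ → ℝ} (hf : ConcaveOn ℝ (Set.Ici 0) f)
    (h0 : ∀ t, 0 ≤ t → 0 ≤ f t) : MonotoneOn f (Set.Ici 0) := by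
  intro x hx y hy hxy
  rcases hxy.eq_or_lt with rfl | hlt
  · exact le_rfl
  by_contra! hcon
  -- The line through (x, f x) and (y, f y) takes the value -1 at z, and concavity keeps f below it
  -- there.
  set z := y + (y - x) * (f y + 1) / (f x - f y) with hz
  have hx0 : (0 : ℝ) ≤ x := hx
  have hfy := h0 y hy
  have hyz : y < z := by
    have : 0 < (y - x) * (f y + 1) / (f x - f y) :=
      div_pos (mul_pos (by linarith) (by linarith)) (by linarith)
    linarith
  have hz0 : (0 : ℝ) ≤ z := by linarith
  have h := hf.slope_anti_adjacent hx (show z ∈ Set.Ici 0 from hz0) hlt hyz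
  have hfz := h0 z hz0
  rw [div_le_div_iff₀ (by linarith) (by linarith)] at h
  have h2 : (z - y) * (f x - f y) = (y - x) * (f y + 1) := by
    rw [hz]; field_simp [(by linarith : f x - f y ≠ 0)]; ring
  nlinarith

theorem ConvexOn.exists_subgradient {φ : ℝ → ℝ} {s : Set ℝ} (hφ : ConvexOn ℝ s φ) {x : ℝ}
    (hx : x ∈ interior s) : ∃ c, ∀ y ∈ s, φ x + c * (y - x) ≤ φ y := by
  have hxs := interior_subset hx
  refine ⟨derivWithin φ (Set.Ioi x) x, fun y hy => ?_⟩
  rcases lt_trichotomy x y with h | rfl | h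
  · have := hφ.rightDeriv_le_slope_of_mem_interior hx hy h
    rw [slope_def_field, le_div_iff₀ (by linarith)] at this
    linarith
  · simp
  · have h1 := hφ.leftDeriv_le_rightDeriv_of_mem_interior hx
    have h2 := hφ.slope_le_leftDeriv_of_mem_interior hy hx h
    have h3 := h2.trans h1
    rw [slope_def_field, div_le_iff₀ (by linarith)] at h3
    linarith

theorem ConcaveOn.exists_supergradient_Ici {f : ℝ → ℝ} (hf : ConcaveOn ℝ (Set.Ici 0) f)
    (h0 : ∀ t, 0 ≤ t → 0 ≤ f t) {α : ℝ} (hα : 0 < α) :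
    ∃ c, 0 ≤ c ∧ ∀ s, 0 ≤ s → f s ≤ f α + c * (s - α) := by
  obtain ⟨c, hc⟩ := hf.neg.exists_subgradient (x := α) (by simpa using hα)
  refine ⟨-c, ?_, fun s hs => ?_⟩
  · have h1 := hc (α + 1) (by simp; linarith)
    have h2 := hf.monotoneOn_Ici_of_nonneg h0 (show α ∈ Set.Ici 0 from hα.le)
      (show α + 1 ∈ Set.Ici 0 by simp; linarith) (by linarith)
    simp only [Pi.neg_apply] at h1
    linarith
  · have := hc s hs
    simp only [Pi.neg_apply] at this
    linarith

/-- The tangent to f ∘ exp at log σⱼ bounds f(sⱼ) - f(σⱼ) below by a slope times log sⱼ - log σⱼ.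
The slopes are nonnegative and decrease with j, so Abel summation applies to the logarithms of the
products. -/
theorem sum_le_sum_of_prod_le_prod {n : ℕ} (f : ℝ → ℝ)
    (hmono : MonotoneOn f (Set.Ici 0)) (hf : IsEConvex f) (σ s : Fin n → ℝ)
    (hσ : Antitone σ) (hσ0 : ∀ j, 0 ≤ σ j) (hs0 : ∀ j, 0 ≤ s j)
    (h : ∀ k, ∏ j ∈ Finset.Iic k, σ j ≤ ∏ j ∈ Finset.Iic k, s j) (k : Fin n) :
    ∑ j ∈ Finset.Iic k, f (σ j) ≤ ∑ j ∈ Finset.Iic k, f (s j) := by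
  have hsub : ∀ x : ℝ, ∃ c, ∀ y, f (Real.exp x) + c * (y - x) ≤ f (Real.exp y) := fun x => by
    obtain ⟨c, hc⟩ := ConvexOn.exists_subgradient hf (x := x) (by simp)
    exact ⟨c, fun y => hc y trivial⟩
  choose C hC using hsub
  have hCmono : Monotone C := by
    intro x y hxy
    rcases hxy.eq_or_lt with rfl | hlt
    · exact le_rfl
    · nlinarith [hC x y, hC y x]
  have hC0 : ∀ x, 0 ≤ C x := by
    intro x
    have h1 := hC x (x - 1)
    have h2 : f (Real.exp (x - 1)) ≤ f (Real.exp x) :=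
      hmono (Real.exp_pos _).le (Real.exp_pos _).le (Real.exp_le_exp.mpr (by linarith))
    linarith
  have hpos : ∀ k, 0 < σ k → ∀ j ≤ k, 0 < σ j := fun k hk j hj => hk.trans_le (hσ hj)
  have hprod : ∀ k, 0 < σ k → 0 < ∏ j ∈ Finset.Iic k, σ j := fun k hk =>
    Finset.prod_pos fun j hj => hpos k hk j (Finset.mem_Iic.mp hj)
  have hspos : ∀ k, 0 < σ k → ∀ j ≤ k, 0 < s j := by
    intro k hk j hj
    refine (hs0 j).lt_of_ne' fun h0 => ?_
    have h1 := (hprod k hk).trans_le (h k)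
    rw [Finset.prod_eq_zero (Finset.mem_Iic.mpr hj) h0] at h1
    exact lt_irrefl _ h1
  -- Cutting the slopes to zero beyond k and where σⱼ = 0 keeps the weights antitone, and logarithms
  -- of products are needed only where all factors are positive.
  set c : Fin n → ℝ := fun j => if j ≤ k ∧ 0 < σ j then C (Real.log (σ j)) else 0 with hcdef
  set a : Fin n → ℝ := fun j => Real.log (s j) - Real.log (σ j) with hadef
  have key : 0 ≤ ∑ j, c j * a j := by
    refine sum_mul_nonneg_of_antitone c a ?_ ?_ ?_
    · intro i j hij
      simp only [hcdef]
      split_ifs with h1 h2 h2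
      · exact hCmono (Real.log_le_log h1.2 (hσ hij))
      · exact absurd ⟨hij.trans h1.1, hpos _ h1.2 _ hij⟩ h2
      · exact hC0 _
      · exact le_rfl
    · intro j
      simp only [hcdef]
      split_ifs
      · exact hC0 _
      · exact le_rfl
    · intro k' hk'
      have hσk' : 0 < σ k' := by
        by_contra hn
        simp [hcdef, hn] at hk'
      simp only [hadef, Finset.sum_sub_distrib]
      rw [← Real.log_prod fun j hj => (hspos k' hσk' j (Finset.mem_Iic.mp hj)).ne',
        ← Real.log_prod fun j hj => (hpos k' hσk' j (Finset.mem_Iic.mp hj)).ne']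
      exact sub_nonneg.mpr (Real.log_le_log (hprod k' hσk') (h k'))
  have hsum : ∑ j, c j * a j = ∑ j ∈ Finset.Iic k, c j * a j := by
    symm
    apply Finset.sum_subset (Finset.subset_univ _)
    intro j _ hj
    have : ¬ j ≤ k := fun h => hj (Finset.mem_Iic.mpr h)
    simp [hcdef, this]
  rw [hsum] at key
  rw [← sub_nonneg, ← Finset.sum_sub_distrib]
  refine key.trans (Finset.sum_le_sum fun j hj => ?_)
  have hjk := Finset.mem_Iic.mp hj
  by_cases hj0 : 0 < σ j
  · have h1 := hC (Real.log (σ j)) (Real.log (s j))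
    rw [Real.exp_log hj0, Real.exp_log (hspos j hj0 j le_rfl)] at h1
    simp only [hcdef, hadef, hjk, hj0, and_self, if_true]
    linarith
  · have h1 : σ j = 0 := le_antisymm (not_lt.mp hj0) (hσ0 j)
    have h2 : f (σ j) ≤ f (s j) := hmono (hσ0 j) (hs0 j) (h1 ▸ hs0 j)
    simp only [hcdef, hj0, and_false, if_false, zero_mul]
    linarith

/-- Put uⱼ = αwⱼ/sⱼ. A supergradient c at α gives uⱼf(sⱼ) ≤ (f(α) - cα)uⱼ + cαwⱼ with f(α) - cα ≥ 0,
so it is enough that Σu ≤ Σw over the initial segment. As s decreases, uⱼ ≤ wⱼ until sⱼ drops below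
α and uⱼ ≥ wⱼ from then on; the totals Σu ≤ 1 ≤ Σw settle the second case. -/
theorem sum_weight_mul_le {n : ℕ} (f : ℝ → ℝ) (h0 : ∀ t, 0 ≤ t → 0 ≤ f t)
    (hf : ConcaveOn ℝ (Set.Ici 0) f) (s w : Fin n → ℝ) (α : ℝ) (hα : 0 ≤ α)
    (hs : Antitone s) (hs0 : ∀ j, 0 ≤ s j) (hw : ∀ j, 0 ≤ w j)
    (hle : ∀ j, α * w j ≤ s j) (hW : 1 ≤ ∑ j, w j) (hq : ∑ j, α * w j / s j ≤ 1) (k : Fin n) :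
    ∑ j ∈ (Finset.Iic k).filter (fun j => 0 < s j), α * w j / s j * f (s j)
      ≤ ∑ j ∈ (Finset.Iic k).filter (fun j => 0 < s j), f α * w j := by
  rcases hα.eq_or_lt with rfl | hα
  · simp only [zero_mul, zero_div, Finset.sum_const_zero]
    exact Finset.sum_nonneg fun j _ => mul_nonneg (h0 0 le_rfl) (hw j)
  set J := (Finset.Iic k).filter (fun j => 0 < s j) with hJ
  have hJs : ∀ j ∈ J, 0 < s j := fun j hj => (Finset.mem_filter.mp hj).2
  have hwu : ∑ j ∈ J, α * w j / s j ≤ ∑ j ∈ J, w j := by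
    by_cases hall : ∀ j ∈ J, α ≤ s j
    · refine Finset.sum_le_sum fun j hj => ?_
      rw [div_le_iff₀ (hJs j hj), mul_comm]
      exact mul_le_mul_of_nonneg_left (hall j hj) (hw j)
    -- The segment already reaches below α, so w ≤ u off it; subtract this from the totals. Where sⱼ
    -- = 0, the bound αwⱼ ≤ sⱼ forces wⱼ = 0.
    · push Not at hall
      obtain ⟨j₀, hj₀, hlt⟩ := hall
      have hc : ∑ j ∈ Jᶜ, w j ≤ ∑ j ∈ Jᶜ, α * w j / s j := by
        refine Finset.sum_le_sum fun j hj => ?_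
        rcases (hs0 j).eq_or_lt with h | h
        · have : w j = 0 := by
            have := hle j
            rw [← h] at this
            nlinarith [hw j]
          simp [this]
        · have hjk : ¬ j ≤ k := fun hjk =>
            Finset.mem_compl.mp hj (Finset.mem_filter.mpr ⟨Finset.mem_Iic.mpr hjk, h⟩)
          have : s j ≤ s j₀ :=
            hs ((Finset.mem_Iic.mp (Finset.mem_filter.mp hj₀).1).trans (not_le.mp hjk).le)
          rw [le_div_iff₀ h, mul_comm]
          exact mul_le_mul_of_nonneg_right (by linarith) (hw j)
      rw [← Finset.sum_add_sum_compl J] at hW hq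
      linarith
  obtain ⟨c, hc0, hc⟩ := hf.exists_supergradient_Ici h0 hα
  have hd : 0 ≤ f α - c * α := by linarith [hc 0 le_rfl, h0 0 le_rfl]
  calc ∑ j ∈ J, α * w j / s j * f (s j)
      ≤ ∑ j ∈ J, ((f α - c * α) * (α * w j / s j) + c * α * w j) := by
        refine Finset.sum_le_sum fun j hj => ?_
        have hsj := hJs j hj
        have h1 : 0 ≤ α * w j / s j := by have := hw j; positivity
        have h2 := mul_le_mul_of_nonneg_left (hc (s j) hsj.le) h1
        have h3 : α * w j / s j * s j = α * w j := div_mul_cancel₀ _ hsj.ne'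
        calc _ ≤ _ := h2
          _ = (f α - c * α) * (α * w j / s j) + c * (α * w j / s j * s j) := by ring
          _ = _ := by rw [h3]; ring
    _ = (f α - c * α) * ∑ j ∈ J, α * w j / s j + c * α * ∑ j ∈ J, w j := by
        rw [Finset.sum_add_distrib, Finset.mul_sum, Finset.mul_sum]
    _ ≤ (f α - c * α) * ∑ j ∈ J, w j + c * α * ∑ j ∈ J, w j := by gcongr
    _ = ∑ j ∈ J, f α * w j := by rw [← Finset.mul_sum]; ring

/-- For sⱼ > 0 the numbers αᵣwᵣⱼ/sⱼ sum to 1 over r, so f(sⱼ) splits over r and each r is treated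
alone. Where sⱼ = 0, monotonicity and the column sums suffice. -/
theorem sum_le_sum_sum_weight {n : ℕ} {ι : Type*} [Fintype ι] (f : ℝ → ℝ)
    (h0 : ∀ t, 0 ≤ t → 0 ≤ f t) (hf : ConcaveOn ℝ (Set.Ici 0) f) (s : Fin n → ℝ)
    (α : ι → ℝ) (w : ι → Fin n → ℝ) (hα : ∀ r, 0 ≤ α r) (hs : Antitone s)
    (hw : ∀ r j, 0 ≤ w r j) (hsum : ∀ j, s j = ∑ r, α r * w r j)
    (hrow : ∀ r, 1 ≤ ∑ j, w r j) (hcol : ∀ j, 1 ≤ ∑ r, w r j)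
    (hq : ∀ r, ∑ j, α r * w r j / s j ≤ 1) (k : Fin n) :
    ∑ j ∈ Finset.Iic k, f (s j) ≤ ∑ j ∈ Finset.Iic k, ∑ r, f (α r) * w r j := by
  have hs0 : ∀ j, 0 ≤ s j := fun j => by
    rw [hsum]; exact Finset.sum_nonneg fun r _ => mul_nonneg (hα r) (hw r j)
  rw [← Finset.sum_filter_add_sum_filter_not _ (fun j => 0 < s j),
    ← Finset.sum_filter_add_sum_filter_not (Finset.Iic k) (fun j => 0 < s j)
      (fun j => ∑ r, f (α r) * w r j)]
  refine add_le_add ?_ ?_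
  · calc ∑ j ∈ (Finset.Iic k).filter (fun j => 0 < s j), f (s j)
        = ∑ j ∈ (Finset.Iic k).filter (fun j => 0 < s j), ∑ r, α r * w r j / s j * f (s j) := by
          refine Finset.sum_congr rfl fun j hj => ?_
          have hsj := (Finset.mem_filter.mp hj).2
          rw [← Finset.sum_mul, ← Finset.sum_div, ← hsum, div_self hsj.ne', one_mul]
      _ = ∑ r, ∑ j ∈ (Finset.Iic k).filter (fun j => 0 < s j), α r * w r j / s j * f (s j) :=
          Finset.sum_comm
      _ ≤ ∑ r, ∑ j ∈ (Finset.Iic k).filter (fun j => 0 < s j), f (α r) * w r j := by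
          refine Finset.sum_le_sum fun r _ =>
            sum_weight_mul_le f h0 hf s (w r) (α r) (hα r) hs hs0 (hw r) (fun j => ?_)
              (hrow r) (hq r) k
          rw [hsum]
          exact Finset.single_le_sum (f := fun r => α r * w r j)
            (fun r _ => mul_nonneg (hα r) (hw r j)) (Finset.mem_univ r)
      _ = _ := Finset.sum_comm
  · refine Finset.sum_le_sum fun j hj => ?_
    have hsj : s j = 0 := le_antisymm (not_lt.mp (Finset.mem_filter.mp hj).2) (hs0 j)
    rw [hsj]
    calc f 0 ≤ f 0 * ∑ r, w r j := le_mul_of_one_le_right (h0 0 le_rfl) (hcol j)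
      _ = ∑ r, f 0 * w r j := Finset.mul_sum _ _ _
      _ ≤ _ := Finset.sum_le_sum fun r _ => mul_le_mul_of_nonneg_right
          (hf.monotoneOn_Ici_of_nonneg h0 (show (0:ℝ) ∈ Set.Ici 0 by simp) (hα r) (hα r)) (hw r j)

/-! ### Symmetric norms: gauge functions and pinching -/

theorem Seminorm.exists_linearMap_eq_of_le {E : Type*} [AddCommGroup E] [Module ℝ E]
    (p : Seminorm ℝ E) (x : E) : ∃ g : E →ₗ[ℝ] ℝ, g x = p x ∧ ∀ y, g y ≤ p y := by
  by_cases hx : x = 0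
  · exact ⟨0, by simp [hx], fun y => by simp⟩
  obtain ⟨g, hg, hle⟩ := exists_extension_of_le_sublinear
    (LinearPMap.mkSpanSingleton (K := ℝ) x (p x) hx) p
    (fun c hc y => by rw [map_smul_eq_mul, Real.norm_of_nonneg hc.le])
    (fun y z => map_add_le_add p y z) (by
      rintro ⟨y, hy⟩
      obtain ⟨t, rfl⟩ := Submodule.mem_span_singleton.mp hy
      rw [LinearPMap.mkSpanSingleton'_apply]
      simp only [smul_eq_mul, map_smul_eq_mul, Real.norm_eq_abs, RingHom.id_apply]
      exact mul_le_mul_of_nonneg_right (le_abs_self t) (apply_nonneg p x))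
  refine ⟨g, ?_, hle⟩
  have h1 := hg ⟨x, Submodule.mem_span_singleton_self x⟩
  have h2 := LinearPMap.mkSpanSingleton_apply ℝ ℝ (σ := RingHom.id ℝ) hx (p x)
  exact h1.trans h2

/-- A symmetric gauge function is monotone under (one-sided) weak majorization. -/
theorem Seminorm.le_of_sum_Iic_le {n : ℕ} (p : Seminorm ℝ (Fin n → ℝ))
    (hperm : ∀ (π : Equiv.Perm (Fin n)) y, p (y ∘ π) = p y)
    (hsign : ∀ (ε y : Fin n → ℝ), (∀ i, ε i = 1 ∨ ε i = -1) → p (ε * y) = p y)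
    (x d : Fin n → ℝ) (hx : Antitone x) (hx0 : ∀ j, 0 ≤ x j)
    (h : ∀ k, ∑ j ∈ Finset.Iic k, x j ≤ ∑ j ∈ Finset.Iic k, d j) : p x ≤ p d := by
  obtain ⟨g, hgx, hg⟩ := p.exists_linearMap_eq_of_le x
  set c : Fin n → ℝ := fun j => g (Pi.single j 1) with hc
  have hgc : ∀ y, g y = ∑ j, c j * y j := by
    intro y
    conv_lhs => rw [← Finset.univ_sum_single y]
    rw [map_sum]
    refine Finset.sum_congr rfl fun j _ => ?_
    rw [show (Pi.single j (y j) : Fin n → ℝ) = y j • Pi.single j 1 by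
      rw [← Pi.single_smul]; simp, map_smul, smul_eq_mul, mul_comm]
  -- Sorting |c| decreasingly can only raise its pairing with the decreasing x, by rearrangement;
  -- Abel summation then replaces x by d.
  set π := Tuple.sort (fun j => -|c j|) with hπ
  set b : Fin n → ℝ := fun j => |c (π j)| with hb
  have hbanti : Antitone b := fun i j hij => by
    have := Tuple.monotone_sort (fun j => -|c j|) hij
    simp only [Function.comp_apply, ← hπ] at this
    simp only [hb]; linarith
  have hmono : Monovary x b := hx.monovary hbanti
  have h1 : ∑ j, c j * x j ≤ ∑ j, b j * x j := by
    calc ∑ j, c j * x j ≤ ∑ j, x j • b (π⁻¹ j) := Finset.sum_le_sum fun j _ => by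
          simp only [hb, smul_eq_mul]
          rw [show π (π⁻¹ j) = j from π.apply_symm_apply j, mul_comm]
          exact mul_le_mul_of_nonneg_left (le_abs_self _) (hx0 j)
      _ ≤ ∑ j, x j • b j := hmono.sum_smul_comp_perm_le_sum_smul
      _ = _ := Finset.sum_congr rfl fun j _ => by rw [smul_eq_mul, mul_comm]
  have h2 : ∑ j, b j * x j ≤ ∑ j, b j * d j := by
    have := sum_mul_nonneg_of_antitone b (fun j => d j - x j) hbanti (fun j => abs_nonneg _)
      (fun k _ => by rw [Finset.sum_sub_distrib]; linarith [h k])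
    simp only [mul_sub, Finset.sum_sub_distrib] at this
    linarith
  set ε : Fin n → ℝ := fun i => if 0 ≤ c i then 1 else -1 with hε
  have hcε : ∀ i, c i * ε i = |c i| := fun i => by
    simp only [hε]
    split_ifs with h0
    · rw [abs_of_nonneg h0, mul_one]
    · rw [abs_of_neg (not_le.mp h0)]; ring
  -- The sorted pairing with d is g at a signed permutation of d, where p takes the same value as at
  -- d.
  have h3 : ∑ j, b j * d j = g (ε * (d ∘ ⇑π⁻¹)) := by
    rw [hgc, ← Equiv.sum_comp π (fun i => c i * (ε * (d ∘ ⇑π⁻¹)) i)]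
    refine Finset.sum_congr rfl fun j _ => ?_
    simp only [Pi.mul_apply, Function.comp_apply, hb]
    rw [show π⁻¹ (π j) = j from π.symm_apply_apply j, ← mul_assoc, hcε]
  calc p x = ∑ j, c j * x j := by rw [← hgx, hgc]
    _ ≤ _ := h1.trans h2
    _ = _ := h3
    _ ≤ p (ε * (d ∘ ⇑π⁻¹)) := hg _
    _ = p d := by
      rw [hsign _ _ fun i => by by_cases h0 : 0 ≤ c i <;> simp [hε, h0], hperm]

/-- The diagonal embedding of real vectors into complex matrices. -/
noncomputable def realDiagonal (n : ℕ) : (Fin n → ℝ) →ₗ[ℝ] Matrix (Fin n) (Fin n) ℂ where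
  toFun y := Matrix.diagonal fun i => (y i : ℂ)
  map_add' x y := by simp [Matrix.diagonal_add]
  map_smul' r y := by
    ext i j
    by_cases h : i = j <;> simp [Matrix.diagonal, h]

theorem realDiagonal_apply {n : ℕ} (y : Fin n → ℝ) :
    realDiagonal n y = Matrix.diagonal fun i => (y i : ℂ) := rfl

theorem Matrix.signDiagonal_mem_unitaryGroup {n : ℕ} (ε : Fin n → ℝ)
    (hε : ∀ i, ε i = 1 ∨ ε i = -1) :
    (Matrix.diagonal fun i => (ε i : ℂ)) ∈ Matrix.unitaryGroup (Fin n) ℂ := by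
  rw [Matrix.mem_unitaryGroup_iff, Matrix.star_eq_conjTranspose, Matrix.diagonal_conjTranspose,
    Matrix.diagonal_mul_diagonal, ← Matrix.diagonal_one]
  congr 1
  ext i
  rcases hε i with h | h <;> simp [h]

theorem Matrix.submatrix_one_mem_unitaryGroup {n : ℕ} (π : Equiv.Perm (Fin n)) :
    ((1 : Matrix (Fin n) (Fin n) ℂ).submatrix π id) ∈ Matrix.unitaryGroup (Fin n) ℂ := by
  rw [Matrix.mem_unitaryGroup_iff, Matrix.star_eq_conjTranspose, Matrix.conjTranspose_submatrix,
    Matrix.conjTranspose_one, ← Matrix.submatrix_mul _ _ π id π Function.bijective_id]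
  simp

theorem IsSymmetricNorm.diagonal_le {n : ℕ} {N : Seminorm ℂ (Matrix (Fin n) (Fin n) ℂ)}
    (hN : IsSymmetricNorm N) (x d : Fin n → ℝ) (hx : Antitone x) (hx0 : ∀ j, 0 ≤ x j)
    (h : ∀ k, ∑ j ∈ Finset.Iic k, x j ≤ ∑ j ∈ Finset.Iic k, d j) :
    N (Matrix.diagonal fun i => (x i : ℂ)) ≤ N (Matrix.diagonal fun i => (d i : ℂ)) := by
  refine Seminorm.le_of_sum_Iic_le ((N.restrictScalars ℝ).comp (realDiagonal n)) ?_ ?_ x d hx hx0 h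
  · intro π y
    simp only [Seminorm.comp_apply, Seminorm.coe_restrictScalars, realDiagonal_apply]
    rw [← hN.unitary_invariant (Matrix.diagonal fun i => (y i : ℂ)) _ _
      (Matrix.submatrix_one_mem_unitaryGroup π)
      (Unitary.star_mem (Matrix.submatrix_one_mem_unitaryGroup π))]
    congr 1
    ext i j
    simp [Matrix.star_eq_conjTranspose, Matrix.mul_apply, Matrix.diagonal, Matrix.one_apply]
    split_ifs with hij <;> simp [hij]
  · intro ε y hε
    simp only [Seminorm.comp_apply, Seminorm.coe_restrictScalars, realDiagonal_apply]
    rw [← hN.unitary_invariant (Matrix.diagonal fun i => (y i : ℂ)) _ 1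
      (Matrix.signDiagonal_mem_unitaryGroup ε hε) (one_mem _), mul_one,
      Matrix.diagonal_mul_diagonal]
    simp

theorem sum_units_pi_mul_eq_zero {n : ℕ} {i j : Fin n} (hij : i ≠ j) :
    ∑ ε : Fin n → ℤˣ, (((ε i : ℤ) : ℂ) * ((ε j : ℤ) : ℂ)) = 0 := by
  have h := Equiv.sum_comp (Equiv.mulLeft (Pi.mulSingle i (-1) : Fin n → ℤˣ))
    (fun ε => (((ε i : ℤ) : ℂ) * ((ε j : ℤ) : ℂ)))
  simp only [Equiv.coe_mulLeft, Pi.mul_apply, Pi.mulSingle_eq_same,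
    Pi.mulSingle_eq_of_ne hij.symm] at h
  simp only [Units.val_neg, one_mul, neg_mul, Int.cast_neg,
    Finset.sum_neg_distrib] at h
  exact self_eq_neg.mp h.symm

/-- Averaging DYD over all diagonal sign matrices D cancels the off-diagonal entries, and each term
has the norm of Y. -/
theorem IsSymmetricNorm.diagonal_diag_le {n : ℕ} {N : Seminorm ℂ (Matrix (Fin n) (Fin n) ℂ)}
    (hN : IsSymmetricNorm N) (Y : Matrix (Fin n) (Fin n) ℂ) :
    N (Matrix.diagonal Y.diag) ≤ N Y := by
  set D : (Fin n → ℤˣ) → Matrix (Fin n) (Fin n) ℂ :=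
    fun ε => Matrix.diagonal fun i => (((ε i : ℤ) : ℝ) : ℂ) with hD
  have hDu : ∀ ε, D ε ∈ Matrix.unitaryGroup (Fin n) ℂ := fun ε =>
    Matrix.signDiagonal_mem_unitaryGroup _ fun i => by
      rcases Int.units_eq_one_or (ε i) with h | h <;> simp [h]
  have hsum : ∑ ε, D ε * Y * D ε
      = (Fintype.card (Fin n → ℤˣ) : ℂ) • Matrix.diagonal Y.diag := by
    ext i j
    rw [Matrix.sum_apply]
    simp only [hD, Matrix.mul_diagonal, Matrix.diagonal_mul, Matrix.smul_apply, smul_eq_mul]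
    by_cases hij : i = j
    · subst hij
      have : ∀ ε : Fin n → ℤˣ, (((ε i : ℤ) : ℝ) : ℂ) * Y i i * (((ε i : ℤ) : ℝ) : ℂ) = Y i i := by
        intro ε
        rcases Int.units_eq_one_or (ε i) with h | h <;> simp [h]
      rw [Finset.sum_congr rfl fun ε _ => this ε]
      simp
    · have h0 := sum_units_pi_mul_eq_zero hij
      have : ∀ ε : Fin n → ℤˣ, (((ε i : ℤ) : ℝ) : ℂ) * Y i j * (((ε j : ℤ) : ℝ) : ℂ)
          = (((ε i : ℤ) : ℂ) * ((ε j : ℤ) : ℂ)) * Y i j := by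
        intro ε; push_cast; ring
      rw [Finset.sum_congr rfl fun ε _ => this ε, ← Finset.sum_mul, h0,
        Matrix.diagonal_apply_ne _ hij]
      simp
  have h1 : N (∑ ε, D ε * Y * D ε) ≤ ∑ ε, N (D ε * Y * D ε) :=
    Finset.le_sum_of_subadditive N (map_zero N).le (fun a b => map_add_le_add N a b) _ _
  rw [hsum, map_smul_eq_mul, Finset.sum_congr rfl fun ε _ =>
    hN.unitary_invariant Y _ _ (hDu ε) (hDu ε), Finset.sum_const, Finset.card_univ,
    nsmul_eq_mul, Complex.norm_natCast] at h1
  exact le_of_mul_le_mul_left h1 (by exact_mod_cast Fintype.card_pos)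

/-! ### Determinant inequalities and log-majorization -/

theorem Matrix.PosSemidef.one_le_det_one_add {ι : Type*} [Fintype ι] [DecidableEq ι]
    {P : Matrix ι ι ℂ} (hP : P.PosSemidef) : 1 ≤ (1 + P).det := by
  have h := hP.1.spectral_theorem
  rw [Unitary.conjStarAlgAut_apply, mul_assoc] at h
  have hU : star (hP.1.eigenvectorUnitary : Matrix ι ι ℂ) * hP.1.eigenvectorUnitary = 1 :=
    Unitary.coe_star_mul_self _
  rw [h, Matrix.det_one_add_mul_comm, mul_assoc, hU, mul_one, ← Matrix.diagonal_one,
    Matrix.diagonal_add, Matrix.det_diagonal]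
  have : ∀ i, (1 : ℂ) + (RCLike.ofReal ∘ hP.1.eigenvalues) i
      = ((1 + hP.1.eigenvalues i : ℝ) : ℂ) := fun i => by simp
  rw [Finset.prod_congr rfl fun i _ => this i, ← Complex.ofReal_prod, ← Complex.ofReal_one,
    Complex.real_le_real]
  calc (1 : ℝ) = ∏ _i : ι, (1 : ℝ) := by simp
    _ ≤ _ := Finset.prod_le_prod (fun _ _ => zero_le_one) fun i _ => by
      have := hP.eigenvalues_nonneg i
      linarith

/-- For invertible A and B - A = E*E, Sylvester's identity gives det B = det A · det(1 + EA⁻¹E*),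
and the last factor is at least 1. -/
theorem Matrix.PosSemidef.det_le_det {ι : Type*} [Fintype ι] [DecidableEq ι]
    {A B : Matrix ι ι ℂ} (hA : A.PosSemidef) (hAB : (B - A).PosSemidef) : A.det ≤ B.det := by
  by_cases h0 : A.det = 0
  · rw [h0]
    have : B = A + (B - A) := by abel
    rw [this]
    exact (hA.add hAB).det_nonneg
  have hApd : A.PosDef := hA.posDef_iff_det_ne_zero.mpr h0
  obtain ⟨E, hE⟩ := (CStarAlgebra.nonneg_iff_eq_star_mul_self (a := B - A)).mp
    (Matrix.nonneg_iff_posSemidef.mpr hAB)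
  rw [Matrix.star_eq_conjTranspose] at hE
  have hB : B = A * (1 + (A⁻¹ * Eᴴ) * E) := by
    rw [mul_add, mul_one, ← mul_assoc, ← mul_assoc,
      Matrix.mul_nonsing_inv _ (isUnit_iff_ne_zero.mpr h0), one_mul, ← hE]
    abel
  rw [hB, Matrix.det_mul, Matrix.det_one_add_mul_comm, ← mul_assoc]
  have h1 : (E * A⁻¹ * Eᴴ).PosSemidef := hApd.inv.posSemidef.mul_mul_conjTranspose_same E
  exact le_mul_of_one_le_right hA.det_nonneg h1.one_le_det_one_add

theorem Matrix.posSemidef_one_sub_mul_conjTranspose {m ι : Type*} [Fintype m] [DecidableEq m]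
    [Fintype ι] [DecidableEq ι] {X : Matrix m ι ℂ} (hX : Xᴴ * X = 1) :
    (1 - X * Xᴴ).PosSemidef := by
  have h : (1 - X * Xᴴ) = (1 - X * Xᴴ)ᴴ * (1 - X * Xᴴ) := by
    have h1 : X * Xᴴ * (X * Xᴴ) = X * Xᴴ := by
      rw [Matrix.mul_assoc, ← Matrix.mul_assoc Xᴴ, hX, Matrix.one_mul]
    rw [Matrix.conjTranspose_sub, Matrix.conjTranspose_mul, Matrix.conjTranspose_conjTranspose,
      Matrix.conjTranspose_one, sub_mul, mul_sub, mul_sub, h1]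
    simp
  rw [h]
  exact Matrix.posSemidef_conjTranspose_mul_self _

/-- With c = sₖ, the diagonal matrix is dominated by c(1 + FF*), whose entries are max(sⱼ, c). After
compression to Y = X*F, Sylvester's identity turns 1 + YY* into 1 + Y*Y ≤ 1 + F*F, and c(1 + F*F)
has determinant exactly ∏ sⱼ. -/
theorem Matrix.det_compression_diagonal_le {n : ℕ} (s : Fin n → ℝ) (hs : Antitone s)
    (hpos : ∀ j, 0 < s j) (k : Fin n) (X : Matrix (Fin n) (Finset.Iic k) ℂ) (hX : Xᴴ * X = 1) :
    (Xᴴ * Matrix.diagonal (fun j => (s j : ℂ)) * X).det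
      ≤ ((∏ j ∈ Finset.Iic k, s j : ℝ) : ℂ) := by
  set c := s k with hc
  have hc0 : 0 < c := hpos k
  have hd : ∀ j ≤ k, 0 ≤ s j / c - 1 := fun j hj => by
    rw [sub_nonneg, le_div_iff₀ hc0, one_mul]; exact hs hj
  set F : Matrix (Fin n) (Finset.Iic k) ℂ :=
    Matrix.of fun i j => if i = j.1 then ((Real.sqrt (s j / c - 1) : ℝ) : ℂ) else 0 with hF
  have hsqrt : ∀ j ≤ k, ((Real.sqrt (s j / c - 1) : ℝ) : ℂ) * ((Real.sqrt (s j / c - 1) : ℝ) : ℂ)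
      = ((s j / c - 1 : ℝ) : ℂ) := fun j hj => by
    rw [← Complex.ofReal_mul, Real.mul_self_sqrt (hd j hj)]
  have hFF : Fᴴ * F = Matrix.diagonal fun j : Finset.Iic k => ((s j / c - 1 : ℝ) : ℂ) := by
    ext i j
    rw [Matrix.mul_apply, Matrix.diagonal_apply]
    simp only [hF, Matrix.conjTranspose_apply, Matrix.of_apply, apply_ite star, star_zero,
      ite_mul, zero_mul, mul_ite, mul_zero]
    rw [Finset.sum_eq_single (j : Fin n) (fun b _ hb => by simp [hb]) (by simp)]
    by_cases hij : i = j
    · subst hij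
      simp only [if_true, Complex.star_def, Complex.conj_ofReal]
      exact hsqrt _ (Finset.mem_Iic.mp i.2)
    · simp [hij, Ne.symm (Subtype.ext_iff.not.mp hij)]
  have hFF' : F * Fᴴ = Matrix.diagonal fun j : Fin n =>
      if j ≤ k then ((s j / c - 1 : ℝ) : ℂ) else 0 := by
    ext i j
    rw [Matrix.mul_apply, Matrix.diagonal_apply]
    simp only [hF, Matrix.conjTranspose_apply, Matrix.of_apply, apply_ite star, star_zero,
      ite_mul, zero_mul, mul_ite, mul_zero]
    by_cases hik : i ≤ k
    · rw [Finset.sum_eq_single (⟨i, Finset.mem_Iic.mpr hik⟩ : Finset.Iic k)]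
      · by_cases hij : i = j
        · subst hij
          simp only [if_true, hik, Complex.star_def, Complex.conj_ofReal]
          exact hsqrt _ hik
        · simp [hij, Ne.symm hij]
      · intro b _ hb
        have : i ≠ b.1 := fun h => hb (Subtype.ext h.symm)
        simp [this]
      · simp
    · rw [Finset.sum_eq_zero]
      · simp [hik]
      · intro b _
        have : i ≠ b.1 := fun h => hik (h ▸ Finset.mem_Iic.mp b.2)
        simp [this]
  have h1 : ((c : ℂ) • (1 + F * Fᴴ) - Matrix.diagonal (fun j => (s j : ℂ))).PosSemidef := by
    rw [hFF', ← Matrix.diagonal_one, Matrix.diagonal_add, ← Matrix.diagonal_smul,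
      Matrix.diagonal_sub]
    refine Matrix.PosSemidef.diagonal fun j => ?_
    by_cases hj : j ≤ k
    · simp only [Pi.zero_apply, hj, if_true, Pi.smul_apply, smul_eq_mul]
      rw [show (c : ℂ) * (1 + ((s j / c - 1 : ℝ) : ℂ)) - (s j : ℂ) = ((0 : ℝ) : ℂ) by
        have : (c : ℂ) ≠ 0 := by exact_mod_cast hc0.ne'
        push_cast
        field_simp
        ring]
      simp
    · simp only [Pi.zero_apply, hj, if_false, Pi.smul_apply, smul_eq_mul, add_zero, mul_one]
      rw [← Complex.ofReal_sub, ← Complex.ofReal_zero, Complex.real_le_real, sub_nonneg]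
      exact hs (not_le.mp hj).le
  have h2 := h1.conjTranspose_mul_mul_same X
  set Y := Xᴴ * F with hY
  have hYY : Xᴴ * ((c : ℂ) • (1 + F * Fᴴ)) * X = (c : ℂ) • (1 + Y * Yᴴ) := by
    rw [hY, Matrix.conjTranspose_mul, Matrix.conjTranspose_conjTranspose, Matrix.mul_smul,
      Matrix.smul_mul, Matrix.mul_add, Matrix.mul_one, Matrix.add_mul, hX]
    simp only [Matrix.mul_assoc]
  rw [Matrix.mul_sub, Matrix.sub_mul, hYY] at h2
  have hdiag : (Matrix.diagonal (fun j => (s j : ℂ))).PosSemidef :=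
    Matrix.PosSemidef.diagonal fun j => by
      simpa using (hpos j).le
  refine ((hdiag.conjTranspose_mul_mul_same X).det_le_det h2).trans ?_
  rw [Matrix.det_smul, Matrix.det_one_add_mul_comm]
  have h3 : (1 + Yᴴ * Y).PosSemidef :=
    Matrix.PosSemidef.one.add (Matrix.posSemidef_conjTranspose_mul_self Y)
  have h4 : ((1 + Fᴴ * F) - (1 + Yᴴ * Y)).PosSemidef := by
    have := (Matrix.posSemidef_one_sub_mul_conjTranspose hX).conjTranspose_mul_mul_same F
    convert this using 1
    rw [hY, Matrix.conjTranspose_mul, Matrix.conjTranspose_conjTranspose, Matrix.mul_sub,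
      Matrix.sub_mul, Matrix.mul_one]
    simp only [Matrix.mul_assoc]
    abel
  have h5 := h3.det_le_det h4
  have hcc : (0 : ℂ) ≤ (c : ℂ) ^ Fintype.card (Finset.Iic k) := by
    rw [← Complex.ofReal_pow, ← Complex.ofReal_zero, Complex.real_le_real]; positivity
  refine (mul_le_mul_of_nonneg_left h5 hcc).trans (le_of_eq ?_)
  rw [hFF, ← Matrix.diagonal_one, Matrix.diagonal_add, Matrix.det_diagonal,
    ← Finset.prod_coe_sort (Finset.Iic k) s, ← Finset.card_univ, ← Finset.prod_const, ← Finset.prod_mul_distrib,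
    Complex.ofReal_prod]
  refine Finset.prod_congr rfl fun j _ => ?_
  have : (c : ℂ) ≠ 0 := by exact_mod_cast hc0.ne'
  push_cast
  field_simp
  ring

/-- The Schur complement gives BP⁻¹B* ≤ Q; take determinants. -/
theorem Matrix.PosSemidef.det_mul_star_det_le {ι : Type*} [Fintype ι] [DecidableEq ι]
    {P B Q : Matrix ι ι ℂ} (h : (Matrix.fromBlocks P Bᴴ B Q).PosSemidef) (hP : P.PosDef) :
    B.det * star B.det ≤ P.det * Q.det := by
  have : Invertible P := hP.isUnit.invertible
  have h1 : (Q - Bᴴᴴ * P⁻¹ * Bᴴ).PosSemidef :=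
    (Matrix.PosDef.fromBlocks₁₁ Bᴴ Q hP).mp (by simpa using h)
  rw [Matrix.conjTranspose_conjTranspose] at h1
  have h2 := (hP.inv.posSemidef.mul_mul_conjTranspose_same B).det_le_det h1
  have h3 := mul_le_mul_of_nonneg_left h2 hP.posSemidef.det_nonneg
  refine le_of_eq_of_le ?_ h3
  rw [Matrix.det_mul, Matrix.det_mul, Matrix.det_conjTranspose, Matrix.det_nonsing_inv,
    Ring.inverse_eq_inv']
  have := hP.det_pos.ne'
  field_simp

theorem Matrix.prod_singularValues_le {n : ℕ} {S T E U : Matrix (Fin n) (Fin n) ℂ}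
    (hE : E ∈ Matrix.unitaryGroup (Fin n) ℂ) (hU : U ∈ Matrix.unitaryGroup (Fin n) ℂ)
    (s σ : Fin n → ℝ) (hs : Antitone s) (hs0 : ∀ j, 0 ≤ s j) (hσ : Antitone σ)
    (hσ0 : ∀ j, 0 ≤ σ j) (hS : S = E * Matrix.diagonal (fun j => (s j : ℂ)) * Eᴴ)
    (hT : Tᴴ * T = U * Matrix.diagonal (fun j => ((σ j ^ 2 : ℝ) : ℂ)) * Uᴴ)
    (hblock : (Matrix.fromBlocks S Tᴴ T S).PosSemidef) (k : Fin n) :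
    ∏ j ∈ Finset.Iic k, σ j ≤ ∏ j ∈ Finset.Iic k, s j := by
  rcases (hσ0 k).eq_or_lt with h0 | hk
  · rw [Finset.prod_eq_zero (Finset.mem_Iic.mpr le_rfl) h0.symm]
    exact Finset.prod_nonneg fun j _ => hs0 j
  have hσpos : ∀ j : Finset.Iic k, 0 < σ j := fun j => hk.trans_le (hσ (Finset.mem_Iic.mp j.2))
  have hEE : Eᴴ * E = 1 := Matrix.mem_unitaryGroup_iff'.mp hE
  have hEE' : E * Eᴴ = 1 := Matrix.mem_unitaryGroup_iff.mp hE
  have hUU : Uᴴ * U = 1 := Matrix.mem_unitaryGroup_iff'.mp hU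
  set X : Matrix (Fin n) (Finset.Iic k) ℂ := U.submatrix id (fun j => j.1) with hXdef
  set D : Matrix (Finset.Iic k) (Finset.Iic k) ℂ :=
    Matrix.diagonal fun j => (((σ j)⁻¹ : ℝ) : ℂ) with hD
  have hX : Xᴴ * X = 1 := by
    rw [hXdef, Matrix.conjTranspose_submatrix, ← Matrix.submatrix_mul _ _ _ id _
      Function.bijective_id, hUU]
    exact Matrix.submatrix_one _ Subtype.val_injective
  have hXTX : Xᴴ * (Tᴴ * T) * X = Matrix.diagonal fun j : Finset.Iic k =>
      ((σ j ^ 2 : ℝ) : ℂ) := by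
    have h1 : Uᴴ * (Tᴴ * T) * U = Matrix.diagonal (fun j => ((σ j ^ 2 : ℝ) : ℂ)) := by
      rw [hT]
      calc _ = (Uᴴ * U) * Matrix.diagonal (fun j => ((σ j ^ 2 : ℝ) : ℂ)) * (Uᴴ * U) := by
            simp only [mul_assoc]
        _ = _ := by rw [hUU, one_mul, mul_one]
    have h2 : Xᴴ * (Tᴴ * T) * X = (Uᴴ * (Tᴴ * T) * U).submatrix (fun j : Finset.Iic k => j.1)
        (fun j : Finset.Iic k => j.1) := by
      ext i j
      simp [hXdef, Matrix.mul_apply, Matrix.submatrix_apply]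
    rw [h2, h1, Matrix.submatrix_diagonal _ _ Subtype.val_injective]
    rfl
  have hDh : Dᴴ = D := by
    rw [hD, Matrix.diagonal_conjTranspose]
    congr 1
    ext j
    simp
  -- X holds the leading right singular vectors of T, and V the matching left ones. Compressing the
  -- block matrix by X ⊕ V makes its off-diagonal block diag(σⱼ), and the determinant bounds give (∏
  -- σⱼ)² ≤ (∏ sⱼ)².
  set V := T * X * D with hVdef
  have hVTX : Vᴴ * T * X = Matrix.diagonal fun j : Finset.Iic k => (σ j : ℂ) := by
    rw [hVdef, Matrix.conjTranspose_mul, Matrix.conjTranspose_mul, hDh]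
    calc D * (Xᴴ * Tᴴ) * T * X = D * (Xᴴ * (Tᴴ * T) * X) := by simp only [Matrix.mul_assoc]
      _ = _ := by
        rw [hXTX, hD, Matrix.diagonal_mul_diagonal]
        congr 1
        ext j
        rw [← Complex.ofReal_mul]
        congr 1
        field_simp [(hσpos j).ne']
  have hV : Vᴴ * V = 1 := by
    calc Vᴴ * V = Vᴴ * T * X * D := by rw [hVdef]; simp only [Matrix.mul_assoc]
      _ = 1 := by
        rw [hVTX, hD, Matrix.diagonal_mul_diagonal, ← Matrix.diagonal_one]
        congr 1
        ext j
        rw [← Complex.ofReal_mul, mul_inv_cancel₀ (hσpos j).ne', Complex.ofReal_one]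
  -- Adding ε to S makes the corner positive definite, as the Schur complement requires; ε tends to
  -- 0 at the end.
  have main : ∀ ε : ℝ, 0 < ε → ∏ j ∈ Finset.Iic k, σ j ≤ ∏ j ∈ Finset.Iic k, (s j + ε) := by
    intro ε hε
    set Δ : Matrix (Fin n) (Fin n) ℂ := Matrix.diagonal (fun j => ((s j + ε : ℝ) : ℂ)) with hΔ
    have hpos : ∀ j, 0 < s j + ε := fun j => by have := hs0 j; linarith
    have hΔpd : Δ.PosDef := Matrix.PosDef.diagonal fun j => by
      rw [← Complex.ofReal_zero, Complex.real_lt_real]; exact hpos j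
    have hSε : S + (ε : ℂ) • 1 = E * Δ * Eᴴ := by
      rw [hS, ← hEE', hΔ]
      have : Matrix.diagonal (fun j => ((s j + ε : ℝ) : ℂ))
          = Matrix.diagonal (fun j => (s j : ℂ)) + (ε : ℂ) • (1 : Matrix (Fin n) (Fin n) ℂ) := by
        rw [← Matrix.diagonal_one, ← Matrix.diagonal_smul, Matrix.diagonal_add]
        congr 1
        ext j
        simp
      rw [this, mul_add, add_mul, Matrix.mul_smul, Matrix.smul_mul, mul_one]
    have hεps : ((ε : ℂ) • (1 : Matrix (Fin n ⊕ Fin n) (Fin n ⊕ Fin n) ℂ)).PosSemidef :=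
      Matrix.PosSemidef.one.smul (by
        rw [← Complex.ofReal_zero, Complex.real_le_real]; exact hε.le)
    have hb := hblock.add hεps
    rw [← Matrix.fromBlocks_one, Matrix.fromBlocks_smul, Matrix.fromBlocks_add, smul_zero,
      add_zero, add_zero, hSε] at hb
    have hb2 := hb.conjTranspose_mul_mul_same (Matrix.fromBlocks X 0 0 V)
    rw [Matrix.fromBlocks_conjTranspose, Matrix.fromBlocks_multiply, Matrix.fromBlocks_multiply]
      at hb2
    simp only [Matrix.conjTranspose_zero, Matrix.zero_mul, Matrix.mul_zero, add_zero, zero_add]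
      at hb2
    have hcomp : ∀ Y : Matrix (Fin n) (Finset.Iic k) ℂ, Yᴴ * (E * Δ * Eᴴ) * Y
        = (Eᴴ * Y)ᴴ * Δ * (Eᴴ * Y) := fun Y => by
      rw [Matrix.conjTranspose_mul, Matrix.conjTranspose_conjTranspose]
      simp only [Matrix.mul_assoc]
    have hiso : ∀ Y : Matrix (Fin n) (Finset.Iic k) ℂ, Yᴴ * Y = 1 →
        (Eᴴ * Y)ᴴ * (Eᴴ * Y) = 1 := fun Y hY => by
      rw [Matrix.conjTranspose_mul, Matrix.conjTranspose_conjTranspose, Matrix.mul_assoc,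
        ← Matrix.mul_assoc E, hEE', Matrix.one_mul, hY]
    have hdet : ∀ Y : Matrix (Fin n) (Finset.Iic k) ℂ, Yᴴ * Y = 1 →
        (Yᴴ * (E * Δ * Eᴴ) * Y).det ≤ ((∏ j ∈ Finset.Iic k, (s j + ε) : ℝ) : ℂ) := fun Y hY => by
      rw [hcomp]
      exact Matrix.det_compression_diagonal_le (fun j => s j + ε)
        (fun i j hij => by have := hs hij; simp only; linarith) hpos k _ (hiso Y hY)
    have hPpd : (Xᴴ * (E * Δ * Eᴴ) * X).PosDef := by
      rw [hcomp]
      refine hΔpd.conjTranspose_mul_mul_same fun x y hxy => ?_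
      have := congrArg (fun z => (Eᴴ * X)ᴴ *ᵥ z) hxy
      simp only [Matrix.mulVec_mulVec] at this
      rwa [hiso X hX, Matrix.one_mulVec, Matrix.one_mulVec] at this
    have hXTV : Xᴴ * Tᴴ * V = (Vᴴ * T * X)ᴴ := by
      simp only [Matrix.conjTranspose_mul, Matrix.conjTranspose_conjTranspose, Matrix.mul_assoc]
    rw [hXTV] at hb2
    have h1 := hb2.det_mul_star_det_le hPpd
    have hps2 : (Vᴴ * (E * Δ * Eᴴ) * V).PosSemidef := by
      rw [hcomp]; exact hΔpd.posSemidef.conjTranspose_mul_mul_same _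
    have hprod0 : 0 ≤ ∏ j ∈ Finset.Iic k, (s j + ε) := Finset.prod_nonneg fun j _ => (hpos j).le
    have h2 := h1.trans (mul_le_mul (hdet X hX) (hdet V hV) hps2.det_nonneg
      (by rw [← Complex.ofReal_zero, Complex.real_le_real]; exact hprod0))
    rw [hVTX, Matrix.det_diagonal, ← Complex.ofReal_prod,
      Finset.prod_coe_sort (Finset.Iic k) σ, Complex.star_def, Complex.conj_ofReal,
      ← Complex.ofReal_mul, ← Complex.ofReal_mul, Complex.real_le_real] at h2
    exact le_of_sq_le_sq (by rw [sq, sq]; exact h2) hprod0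
  have hcont : Filter.Tendsto (fun ε : ℝ => ∏ j ∈ Finset.Iic k, (s j + ε))
      (nhdsWithin 0 (Set.Ioi 0)) (nhds (∏ j ∈ Finset.Iic k, (s j + 0))) := by
    have : Continuous fun ε : ℝ => ∏ j ∈ Finset.Iic k, (s j + ε) := by fun_prop
    exact (this.tendsto 0).mono_left nhdsWithin_le_nhds
  simp only [add_zero] at hcont
  exact ge_of_tendsto hcont (Filter.eventually_of_mem self_mem_nhdsWithin fun ε hε => main ε hε)

/-! ### Sorted diagonalization and the block matrix of a normal matrix -/

theorem Matrix.IsHermitian.exists_antitone_diagonalization {n : ℕ} {H : Matrix (Fin n) (Fin n) ℂ}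
    (hH : H.IsHermitian) : ∃ U ∈ Matrix.unitaryGroup (Fin n) ℂ, ∃ s : Fin n → ℝ, Antitone s ∧
      H = U * Matrix.diagonal (fun j => (s j : ℂ)) * Uᴴ ∧
      ∀ f : ℝ → ℝ, cfc f H = U * Matrix.diagonal (fun j => (f (s j) : ℂ)) * Uᴴ := by
  set V : Matrix (Fin n) (Fin n) ℂ := hH.eigenvectorUnitary.1 with hV
  have hVmem : V ∈ Matrix.unitaryGroup (Fin n) ℂ := hH.eigenvectorUnitary.2
  set π := Tuple.sort (fun j => -hH.eigenvalues j) with hπ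
  have hanti : Antitone fun j => hH.eigenvalues (π j) := fun i j hij => by
    have := Tuple.monotone_sort (fun j => -hH.eigenvalues j) hij
    simp only [Function.comp_apply, ← hπ] at this
    linarith
  have hperm : ∀ g : Fin n → ℂ, V * Matrix.diagonal g * star V
      = V.submatrix id π * Matrix.diagonal (fun j => g (π j)) * (V.submatrix id π)ᴴ := fun g => by
    rw [Matrix.conjTranspose_submatrix,
      show (fun j => g (π j)) = g ∘ π from rfl,
      ← Matrix.submatrix_diagonal_equiv, Matrix.submatrix_mul_equiv, Matrix.submatrix_mul_equiv,
      Matrix.submatrix_id_id, Matrix.star_eq_conjTranspose]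
  refine ⟨V.submatrix id π, ?_, fun j => hH.eigenvalues (π j), hanti, ?_, fun f => ?_⟩
  · rw [Matrix.mem_unitaryGroup_iff, Matrix.star_eq_conjTranspose, Matrix.conjTranspose_submatrix,
      Matrix.submatrix_mul_equiv, ← Matrix.star_eq_conjTranspose,
      Matrix.mem_unitaryGroup_iff.mp hVmem, Matrix.submatrix_one _ Function.injective_id]
  · have h := hH.spectral_theorem
    rw [Unitary.conjStarAlgAut_apply] at h
    exact h.trans (hperm _)
  · rw [hH.cfc_eq, Matrix.IsHermitian.cfc, Unitary.conjStarAlgAut_apply]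
    exact hperm _

theorem Matrix.nonneg_of_posSemidef_conj_diagonal {n : ℕ} {H U : Matrix (Fin n) (Fin n) ℂ}
    (hH : H.PosSemidef) (hU : U ∈ Matrix.unitaryGroup (Fin n) ℂ) {s : Fin n → ℝ}
    (h : H = U * Matrix.diagonal (fun j => (s j : ℂ)) * Uᴴ) (j : Fin n) : 0 ≤ s j := by
  have h1 := hH.conjTranspose_mul_mul_same U
  have hUU : Uᴴ * U = 1 := Matrix.mem_unitaryGroup_iff'.mp hU
  have h2 : Uᴴ * H * U = Matrix.diagonal (fun j => (s j : ℂ)) := by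
    rw [h]
    calc _ = (Uᴴ * U) * Matrix.diagonal (fun j => (s j : ℂ)) * (Uᴴ * U) := by
          simp only [mul_assoc]
      _ = _ := by rw [hUU, one_mul, mul_one]
  rw [h2] at h1
  have := h1.diag_nonneg (i := j)
  rwa [Matrix.diagonal_apply_eq, ← Complex.ofReal_zero, Complex.real_le_real] at this

/-- The matrix J = [[0, A*], [A, 0]] is self-adjoint with J² = A*A ⊕ AA*. Normality makes |J| = |A|
⊕ |A|, and |J| + J is twice the positive part of J. -/
theorem Matrix.posSemidef_fromBlocks_abs {n : ℕ} (A : Matrix (Fin n) (Fin n) ℂ)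
    (hA : IsStarNormal A) : (Matrix.fromBlocks (CFC.abs A) Aᴴ A (CFC.abs A)).PosSemidef := by
  set J := Matrix.fromBlocks 0 Aᴴ A 0 with hJ
  have hJh : star J = J := by
    rw [Matrix.star_eq_conjTranspose, hJ, Matrix.fromBlocks_conjTranspose]
    simp
  set K := Matrix.fromBlocks (CFC.abs A) 0 0 (CFC.abs A) with hK
  have hK0 : 0 ≤ K := by
    obtain ⟨B, hB⟩ := (CStarAlgebra.nonneg_iff_eq_star_mul_self (a := CFC.abs A)).mp
      (CFC.abs_nonneg A)
    have : K = (Matrix.fromBlocks B 0 0 B)ᴴ * Matrix.fromBlocks B 0 0 B := by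
      rw [hK, Matrix.fromBlocks_conjTranspose, Matrix.fromBlocks_multiply, hB]
      simp [Matrix.star_eq_conjTranspose]
    rw [this]
    exact (Matrix.posSemidef_conjTranspose_mul_self _).nonneg
  have habs : CFC.abs J = K := by
    rw [CFC.abs]
    refine CFC.sqrt_unique ?_ hK0
    rw [hJh, hJ, hK, Matrix.fromBlocks_multiply, Matrix.fromBlocks_multiply, CFC.abs_mul_abs,
      Matrix.star_eq_conjTranspose]
    have h2 : Aᴴ * A = A * Aᴴ := hA.star_comm_self
    simp [h2]
  have h1 : 0 ≤ CFC.abs J + J := by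
    rw [CFC.abs_add_self J hJh]
    exact smul_nonneg zero_le_two (CFC.posPart_nonneg J)
  rw [habs, hK, hJ, Matrix.fromBlocks_add] at h1
  simpa using Matrix.nonneg_iff_posSemidef.mp h1

/-! ### Expansive matrices and the weights they produce -/

/-- Both Schur complements of [[M*M, 1], [1, 1]] are used: one is the hypothesis, the other says 1 -
(M*M)⁻¹ ≥ 0, which is then conjugated by M. -/
theorem IsExpansive.mul_conjTranspose_sub_one_posSemidef {n : ℕ} {M : Matrix (Fin n) (Fin n) ℂ}
    (hM : IsExpansive M) : (M * Mᴴ - 1).PosSemidef := by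
  have hG : (Mᴴ * M).PosDef := by
    have := Matrix.PosDef.one.add_posSemidef hM
    rwa [add_sub_cancel] at this
  have hMu : IsUnit M.det := by
    have h := (Matrix.isUnit_iff_isUnit_det _).mp hG.isUnit
    rw [Matrix.det_mul] at h
    exact isUnit_of_mul_isUnit_right h
  have : Invertible (Mᴴ * M) := hG.isUnit.invertible
  have hb : (Matrix.fromBlocks (Mᴴ * M) 1 1ᴴ (1 : Matrix (Fin n) (Fin n) ℂ)).PosSemidef := by
    have : Invertible (1 : Matrix (Fin n) (Fin n) ℂ) := invertibleOne
    rw [Matrix.PosDef.fromBlocks₂₂ _ _ Matrix.PosDef.one, inv_one, mul_one,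
      Matrix.conjTranspose_one, mul_one]
    exact hM
  rw [Matrix.PosDef.fromBlocks₁₁ _ _ hG, Matrix.conjTranspose_one, one_mul, mul_one] at hb
  have h := hb.mul_mul_conjTranspose_same M
  have hMu' : IsUnit Mᴴ.det := by rw [Matrix.det_conjTranspose]; exact hMu.star
  have hinv : M * (Mᴴ * M)⁻¹ * Mᴴ = 1 := by
    rw [Matrix.mul_inv_rev, ← mul_assoc, Matrix.mul_nonsing_inv _ hMu, one_mul,
      Matrix.nonsing_inv_mul _ hMu']
  rwa [Matrix.mul_sub, Matrix.sub_mul, Matrix.mul_one, hinv] at h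

theorem IsExpansive.unitary_mul_mul_unitary {n : ℕ} {Z P E : Matrix (Fin n) (Fin n) ℂ}
    (hZ : IsExpansive Z) (hP : P ∈ Matrix.unitaryGroup (Fin n) ℂ)
    (hE : E ∈ Matrix.unitaryGroup (Fin n) ℂ) : IsExpansive (Pᴴ * Z * E) := by
  have h := Matrix.PosSemidef.conjTranspose_mul_mul_same hZ E
  have hPP : P * Pᴴ = 1 := Matrix.mem_unitaryGroup_iff.mp hP
  have hEE : Eᴴ * E = 1 := Matrix.mem_unitaryGroup_iff'.mp hE
  unfold IsExpansive
  convert h using 1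
  simp only [Matrix.conjTranspose_mul, Matrix.conjTranspose_conjTranspose, mul_sub, sub_mul,
    mul_one, hEE, sub_left_inj]
  calc _ = Eᴴ * Zᴴ * (P * Pᴴ) * Z * E := by simp only [mul_assoc]
    _ = _ := by rw [hPP, mul_one]; simp only [mul_assoc]

theorem Matrix.conjTranspose_mul_diagonal_mul_apply_self {n : ℕ} {ι : Type*} [Fintype ι]
    [DecidableEq ι] (B : Matrix ι (Fin n) ℂ) (α : ι → ℝ) (j : Fin n) :
    (Bᴴ * Matrix.diagonal (fun r => (α r : ℂ)) * B) j j
      = ((∑ r, α r * ‖B r j‖ ^ 2 : ℝ) : ℂ) := by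
  rw [Matrix.mul_apply]
  simp only [Matrix.mul_diagonal, Matrix.conjTranspose_apply]
  push_cast
  refine Finset.sum_congr rfl fun r _ => ?_
  rw [← Complex.conj_mul', Complex.star_def]
  ring

theorem IsExpansive.one_le_sum_col {n : ℕ} {M : Matrix (Fin n) (Fin n) ℂ} (hM : IsExpansive M)
    (j : Fin n) : 1 ≤ ∑ l, ‖M l j‖ ^ 2 := by
  have h := Matrix.PosSemidef.diag_nonneg hM (i := j)
  have h1 := Matrix.conjTranspose_mul_diagonal_mul_apply_self M (fun _ => 1) j
  simp only [Complex.ofReal_one, Matrix.diagonal_one, Matrix.mul_one, one_mul] at h1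
  rw [Matrix.sub_apply, h1, Matrix.one_apply_eq, ← Complex.ofReal_one, ← Complex.ofReal_sub,
    ← Complex.ofReal_zero, Complex.real_le_real] at h
  linarith

theorem IsExpansive.one_le_sum_row {n : ℕ} {M : Matrix (Fin n) (Fin n) ℂ} (hM : IsExpansive M)
    (l : Fin n) : 1 ≤ ∑ j, ‖M l j‖ ^ 2 := by
  have h : IsExpansive Mᴴ := by
    unfold IsExpansive
    rw [Matrix.conjTranspose_conjTranspose]
    exact hM.mul_conjTranspose_sub_one_posSemidef
  simpa using h.one_le_sum_col l

theorem Matrix.star_dotProduct_diagonal_mulVec {κ : Type*} [Fintype κ] [DecidableEq κ]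
    (a : κ → ℝ) (z : κ → ℂ) : star z ⬝ᵥ (Matrix.diagonal (fun r => (a r : ℂ)) *ᵥ z)
      = ((∑ r, a r * ‖z r‖ ^ 2 : ℝ) : ℂ) := by
  simp only [dotProduct, Matrix.mulVec_diagonal, Pi.star_apply]
  push_cast
  refine Finset.sum_congr rfl fun r _ => ?_
  rw [← Complex.conj_mul', Complex.star_def]
  ring

theorem Matrix.sum_weight_div_le_one {n : ℕ} {ι : Type*} [Fintype ι] [DecidableEq ι]
    (B : Matrix ι (Fin n) ℂ) (α : ι → ℝ) (hα : ∀ r, 0 ≤ α r) (s : Fin n → ℝ)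
    (hs : ∀ j, 0 ≤ s j)
    (h : Bᴴ * Matrix.diagonal (fun r => (α r : ℂ)) * B = Matrix.diagonal fun j => (s j : ℂ))
    (r : ι) : ∑ j, α r * ‖B r j‖ ^ 2 / s j ≤ 1 := by
  set q := ∑ j, ‖B r j‖ ^ 2 / s j with hq
  have hq0 : 0 ≤ q := Finset.sum_nonneg fun j _ => div_nonneg (sq_nonneg _) (hs j)
  -- For this test vector both (Bx)ᵣ and the quadratic form equal q, so keeping only the r-th term
  -- leaves αᵣq² ≤ q. Division by zero gives 0, so indices with sⱼ = 0 drop out.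
  set x : Fin n → ℂ := fun j => star (B r j) / (s j : ℂ) with hx
  set y := B *ᵥ x with hy
  have hyr : y r = (q : ℂ) := by
    simp only [hy, hx, hq, Matrix.mulVec, dotProduct]
    push_cast
    refine Finset.sum_congr rfl fun j _ => ?_
    rw [← Complex.mul_conj', Complex.star_def, mul_div_assoc]
  have hquad : ∑ r, α r * ‖y r‖ ^ 2 = ∑ j, s j * ‖x j‖ ^ 2 := by
    have h1 : star x ⬝ᵥ ((Bᴴ * Matrix.diagonal (fun r => (α r : ℂ)) * B) *ᵥ x)
        = star y ⬝ᵥ (Matrix.diagonal (fun r => (α r : ℂ)) *ᵥ y) := by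
      rw [hy, Matrix.star_mulVec, ← Matrix.mulVec_mulVec, ← Matrix.mulVec_mulVec,
        Matrix.dotProduct_mulVec (star x) Bᴴ]
    rw [h, Matrix.star_dotProduct_diagonal_mulVec, Matrix.star_dotProduct_diagonal_mulVec] at h1
    exact_mod_cast h1.symm
  have hxq : ∑ j, s j * ‖x j‖ ^ 2 = q := by
    refine Finset.sum_congr rfl fun j _ => ?_
    simp only [hx, norm_div, norm_star, Complex.norm_real, Real.norm_of_nonneg (hs j)]
    rcases (hs j).eq_or_lt with h0 | h0
    · simp [← h0]
    · field_simp
  have hle : α r * q ^ 2 ≤ q := by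
    calc α r * q ^ 2 = α r * ‖y r‖ ^ 2 := by simp [hyr]
      _ ≤ ∑ r, α r * ‖y r‖ ^ 2 := Finset.single_le_sum (f := fun r => α r * ‖y r‖ ^ 2)
          (fun r _ => mul_nonneg (hα r) (sq_nonneg _)) (Finset.mem_univ r)
      _ = q := hquad.trans hxq
  have hsum : ∑ j, α r * ‖B r j‖ ^ 2 / s j = α r * q := by
    rw [hq, Finset.mul_sum]
    exact Finset.sum_congr rfl fun j _ => mul_div_assoc _ _ _
  rw [hsum]
  rcases hq0.eq_or_lt with h0 | h0
  · simp [← h0]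
  · nlinarith

/-! ### Assembly of the norm inequality -/

theorem corollary1p4 (n m : ℕ) (hm : 0 < m)
    (A Z : Fin m → Matrix (Fin n) (Fin n) ℂ)
    (hA : ∀ i, IsStarNormal (A i)) (hZ : ∀ i, IsExpansive (Z i))
    (f : ℝ → ℝ) (hf_nonneg : ∀ t : ℝ, 0 ≤ t → 0 ≤ f t)
    (hf_concave : ConcaveOn ℝ (Set.Ici 0) f) (hf_econvex : IsEConvex f)
    (N : Seminorm ℂ (Matrix (Fin n) (Fin n) ℂ)) (hN : IsSymmetricNorm N) :
    N (cfc f (CFC.abs (∑ i, (Z i)ᴴ * A i * Z i))) ≤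
      N (∑ i, (Z i)ᴴ * cfc f (CFC.abs (A i)) * Z i) := by
  set T := ∑ i, (Z i)ᴴ * A i * Z i with hT
  set S := ∑ i, (Z i)ᴴ * CFC.abs (A i) * Z i with hS
  have hmono := hf_concave.monotoneOn_Ici_of_nonneg hf_nonneg
  have habs : ∀ B : Matrix (Fin n) (Fin n) ℂ, (CFC.abs B).PosSemidef := fun B =>
    Matrix.nonneg_iff_posSemidef.mp (CFC.abs_nonneg B)
  have hSpsd : S.PosSemidef := Matrix.posSemidef_sum _ fun i _ =>
    (habs (A i)).conjTranspose_mul_mul_same (Z i)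
  obtain ⟨U, hU, σ, hσ, hTU, hcfcT⟩ := (habs T).1.exists_antitone_diagonalization
  obtain ⟨E, hE, s, hs, hSE, -⟩ := hSpsd.1.exists_antitone_diagonalization
  choose P hP α hαanti hAP hcfcA using fun i => (habs (A i)).1.exists_antitone_diagonalization
  have hσ0 := Matrix.nonneg_of_posSemidef_conj_diagonal (habs T) hU hTU
  have hs0 := Matrix.nonneg_of_posSemidef_conj_diagonal hSpsd hE hSE
  have hα0 : ∀ i l, 0 ≤ α i l := fun i =>
    Matrix.nonneg_of_posSemidef_conj_diagonal (habs (A i)) (hP i) (hAP i)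
  have hUU : Uᴴ * U = 1 := Matrix.mem_unitaryGroup_iff'.mp hU
  have hEE : Eᴴ * E = 1 := Matrix.mem_unitaryGroup_iff'.mp hE
  have hTT : Tᴴ * T = U * Matrix.diagonal (fun j => ((σ j ^ 2 : ℝ) : ℂ)) * Uᴴ := by
    rw [← Matrix.star_eq_conjTranspose, ← CFC.abs_mul_abs, hTU]
    calc _ = U * Matrix.diagonal (fun j => (σ j : ℂ)) * (Uᴴ * U)
          * Matrix.diagonal (fun j => (σ j : ℂ)) * Uᴴ := by simp only [mul_assoc]
      _ = _ := by
        rw [hUU, mul_one, mul_assoc U, Matrix.diagonal_mul_diagonal]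
        simp only [sq, Complex.ofReal_mul]
  have hblock : (Matrix.fromBlocks S Tᴴ T S).PosSemidef := by
    have h1 : Matrix.fromBlocks S Tᴴ T S = ∑ i, (Matrix.fromBlocks (Z i) 0 0 (Z i))ᴴ *
        Matrix.fromBlocks (CFC.abs (A i)) (A i)ᴴ (A i) (CFC.abs (A i)) *
        Matrix.fromBlocks (Z i) 0 0 (Z i) := by
      have h2 : ∀ i, (Matrix.fromBlocks (Z i) 0 0 (Z i))ᴴ *
          Matrix.fromBlocks (CFC.abs (A i)) (A i)ᴴ (A i) (CFC.abs (A i)) *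
          Matrix.fromBlocks (Z i) 0 0 (Z i) = Matrix.fromBlocks
            ((Z i)ᴴ * CFC.abs (A i) * Z i) ((Z i)ᴴ * A i * Z i)ᴴ
            ((Z i)ᴴ * A i * Z i) ((Z i)ᴴ * CFC.abs (A i) * Z i) := fun i => by
        rw [Matrix.fromBlocks_conjTranspose, Matrix.fromBlocks_multiply,
          Matrix.fromBlocks_multiply]
        simp [mul_assoc]
      simp only [h2]
      ext (a | a) (b | b) <;>
        simp [hS, hT, Matrix.sum_apply, Matrix.conjTranspose_sum]
    rw [h1]
    exact Matrix.posSemidef_sum _ fun i _ =>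
      (Matrix.posSemidef_fromBlocks_abs (A i) (hA i)).conjTranspose_mul_mul_same _
  have hstep1 : ∀ k, ∑ j ∈ Finset.Iic k, f (σ j) ≤ ∑ j ∈ Finset.Iic k, f (s j) :=
    sum_le_sum_of_prod_le_prod f hmono hf_econvex σ s hσ hσ0 hs0
      (Matrix.prod_singularValues_le hE hU s σ hs hs0 hσ hσ0 hSE hTT hblock)
  set M : Fin m → Matrix (Fin n) (Fin n) ℂ := fun i => (P i)ᴴ * Z i * E with hM
  have hMexp : ∀ i, IsExpansive (M i) := fun i => (hZ i).unitary_mul_mul_unitary (hP i) hE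
  -- Stacking the Mᵢ turns the sum over i into a single congruence B*DB with D diagonal.
  set B : Matrix (Fin m × Fin n) (Fin n) ℂ := Matrix.of fun r j => M r.1 r.2 j with hB
  have hconj : ∀ g : Fin m → Fin n → ℝ,
      Eᴴ * (∑ i, (Z i)ᴴ * (P i * Matrix.diagonal (fun l => (g i l : ℂ)) * (P i)ᴴ) * Z i) * E
        = Bᴴ * Matrix.diagonal (fun r : Fin m × Fin n => (g r.1 r.2 : ℂ)) * B := fun g => by
    have h1 : Bᴴ * Matrix.diagonal (fun r : Fin m × Fin n => (g r.1 r.2 : ℂ)) * B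
        = ∑ i, (M i)ᴴ * Matrix.diagonal (fun l => (g i l : ℂ)) * M i := by
      ext a b
      rw [Matrix.sum_apply, Matrix.mul_apply, Fintype.sum_prod_type]
      simp only [Matrix.mul_apply (M := (M _)ᴴ * _), Matrix.mul_diagonal,
        Matrix.conjTranspose_apply, hB, Matrix.of_apply]
    rw [h1, Matrix.mul_sum, Matrix.sum_mul]
    refine Finset.sum_congr rfl fun i _ => ?_
    simp only [hM, Matrix.conjTranspose_mul, Matrix.conjTranspose_conjTranspose, mul_assoc]
  have hBs : Bᴴ * Matrix.diagonal (fun r : Fin m × Fin n => (α r.1 r.2 : ℂ)) * B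
      = Matrix.diagonal fun j => (s j : ℂ) := by
    rw [← hconj]
    simp only [← hAP]
    rw [← hS, hSE]
    calc _ = (Eᴴ * E) * Matrix.diagonal (fun j => (s j : ℂ)) * (Eᴴ * E) := by
          simp only [mul_assoc]
      _ = _ := by rw [hEE, one_mul, mul_one]
  set d : Fin n → ℝ := fun j => ∑ r : Fin m × Fin n, f (α r.1 r.2) * ‖B r j‖ ^ 2 with hd
  have hstep2 : ∀ k, ∑ j ∈ Finset.Iic k, f (s j) ≤ ∑ j ∈ Finset.Iic k, d j := by
    refine sum_le_sum_sum_weight f hf_nonneg hf_concave s (fun r : Fin m × Fin n => α r.1 r.2)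
      (fun r j => ‖B r j‖ ^ 2) (fun r => hα0 _ _) hs (fun r j => sq_nonneg _) (fun j => ?_)
      (fun r => (hMexp r.1).one_le_sum_row r.2) (fun j => ?_)
      (Matrix.sum_weight_div_le_one B _ (fun r => hα0 _ _) s hs0 hBs)
    · have h1 := Matrix.conjTranspose_mul_diagonal_mul_apply_self B
        (fun r : Fin m × Fin n => α r.1 r.2) j
      rw [hBs, Matrix.diagonal_apply_eq] at h1
      exact_mod_cast h1
    · rw [Fintype.sum_prod_type]
      -- One block already gives the column bound; this is where m ≥ 1 enters.
      exact ((hMexp ⟨0, hm⟩).one_le_sum_col j).trans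
        (Finset.single_le_sum (f := fun i => ∑ l, ‖B (i, l) j‖ ^ 2)
          (fun i _ => Finset.sum_nonneg fun l _ => sq_nonneg _) (Finset.mem_univ _))
  set Y := ∑ i, (Z i)ᴴ * cfc f (CFC.abs (A i)) * Z i with hY
  have hYd : Matrix.diagonal (fun j => (d j : ℂ)) = Matrix.diagonal (Eᴴ * Y * E).diag := by
    congr 1
    ext j
    rw [hY]
    simp only [hcfcA]
    rw [hconj fun i l => f (α i l), Matrix.diag_apply,
      Matrix.conjTranspose_mul_diagonal_mul_apply_self B fun r => f (α r.1 r.2)]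
  calc N (cfc f (CFC.abs T)) = N (Matrix.diagonal fun j => (f (σ j) : ℂ)) := by
        rw [hcfcT]
        exact hN.unitary_invariant _ _ _ hU (Unitary.star_mem hU)
    _ ≤ N (Matrix.diagonal fun j => (d j : ℂ)) :=
        hN.diagonal_le _ d (fun i j hij => hmono (hσ0 j) (hσ0 i) (hσ hij))
          (fun j => hf_nonneg _ (hσ0 j)) fun k => (hstep1 k).trans (hstep2 k)
    _ ≤ N (Eᴴ * Y * E) := hYd ▸ hN.diagonal_diag_le _
    _ = N Y := hN.unitary_invariant _ _ _ (Unitary.star_mem hE) hE
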